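/- For a positive integer $q$ and positive integers $k_1,k_2$, let $[-k_1,k_2]^\ast=\{-k_1,-k_1+1,\dots,k_2\}\setminus\{0\}$. A set $B\subseteq\mathbb{Z}_q=\mathbb{Z}/q\mathbb{Z}$ is called a $B[-k_1,k_2](q)$ set if, for every $b\in B$, the set $\{ab \bmod q : a\in[-k_1,k_2]^\ast\}$ consists of exactly $k_1+k_2$ elements, all of them nonzero, and these sets are pairwise disjoint for distinct $b\in B$. It is called perfect if $|B|=\frac{q-1}{k_1+k_2}$. Let $k_1,k_2,n$ be positive integers with $k_1+k_2\ge 4$, and let $p$ be a prime with $p\mid k_1+k_2+1$ and $p\ne k_1+k_2+1$. Suppose that there exists a perfect $B[-k_1,k_2](p^n)$ set. Then $p^n=k_1+k_2+1$. -/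

import Mathlib

/-- The multiplier set `[-k₁, k₂]* = {-k₁, …, k₂} \ {0}`. -/
noncomputable def splitterMultipliers (k₁ k₂ : ℕ) : Finset ℤ :=
  (Finset.Icc (-(k₁ : ℤ)) (k₂ : ℤ)).erase 0

/-- The block `{a b mod q : a ∈ [-k₁, k₂]*}` of an element `b` of `ℤ/q`. -/
noncomputable def splitterBlock (k₁ k₂ q : ℕ) (b : ZMod q) : Finset (ZMod q) :=
  (splitterMultipliers k₁ k₂).image fun a : ℤ => (a : ZMod q) * b

/-- `B` is a `B[-k₁, k₂](q)` set: every block of an element of `B` consists of `k₁ + k₂` nonzero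
elements, and the blocks of different elements of `B` are disjoint. -/
structure IsSplitterSet (k₁ k₂ q : ℕ) (B : Finset (ZMod q)) : Prop where
  zero_notMem : ∀ b ∈ B, (0 : ZMod q) ∉ splitterBlock k₁ k₂ q b
  card_block : ∀ b ∈ B, (splitterBlock k₁ k₂ q b).card = k₁ + k₂
  disjoint_blocks : ∀ b ∈ B, ∀ c ∈ B, b ≠ c →
    Disjoint (splitterBlock k₁ k₂ q b) (splitterBlock k₁ k₂ q c)

/-- `B` is a perfect `B[-k₁, k₂](q)` set: it is a splitter set of the size
`(q - 1) / (k₁ + k₂)` (exact quotient, written without division). -/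
structure IsPerfectSplitterSet (k₁ k₂ q : ℕ) (B : Finset (ZMod q)) : Prop where
  isSplitterSet : IsSplitterSet k₁ k₂ q B
  card_eq : (k₁ + k₂) * B.card + 1 = q

/-!
Let `k₁ + k₂ + 1 = p * u`. A perfect set `B` factors the group of units modulo `p ^ n` as the
multipliers prime to `p` times the units of `B`. Comparing sizes, `u` is a power of `p`, so
`k₁ + k₂ + 1 = p ^ t` with `t ≥ 2`, and `p ^ t - 1 ∣ p ^ n - 1` gives `t ∣ n`
(`IsPerfectSplitterSet.exists_exponent`). It remains to refute `n ≥ 2 * t`.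

A nontrivial character `χ` of the units sums to zero over one of the two factors
(`sum_mul_sum_eq_zero_of_factorization`). When `χ` has `p`-power order, a set with vanishing
character sum is rigid: its values are permuted by multiplication by `p`-th roots of unity
(`exists_eq_mul_of_sum_eq_zero`).

For odd `p`, let `χ` have order `p ^ (n - 1)`. A set with vanishing sum has two elements congruent
modulo `p ^ (n - 1)`, since a fibre would need `p` elements in a coset of the `p - 1` solutions of
`x ^ (p - 1) = 1`. But the multipliers are distinct modulo `p ^ (n - 1)` because they are small, and
the elements of `B` are, because `p` or `-p` is a multiplier.

For `p = 2`, `t ≥ 3` since `k₁ + k₂ ≥ 4`. Use characters modulo `2 ^ m` with kernel `{1, -1}`, for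
`m = n` and for `m = n - 1`; in the second case the multipliers of exact valuation one, halved, play
the role of the odd ones. Multipliers are too small for their sum to vanish, so the sum over the
units of `B` vanishes at both levels. This puts three different elements of `B` into the two classes
`±x` modulo `2 ^ (n - 2)`, although elements of `B` are distinct there because `4` or `-4` is a
multiplier.
-/

/-! ### Vanishing character sums -/

/-- If a sum of `p`-power roots of unity vanishes, the set of its terms is closed under
multiplication by `p`-th roots of unity. Write the terms as powers of a primitive `N`-th root of
unity `ω`, `N = p ^ (e + 1)`. The polynomial of exponents is divisible by `Φ_N`, hence its product
with `X ^ p ^ e - 1` is divisible by `X ^ N - 1`; in the group ring `ℤ[ℤ/N]` this says that the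
multiset of exponents is invariant under translation by `p ^ e`. -/
theorem exists_eq_mul_of_sum_eq_zero {ι : Type*} {p e : ℕ} (hp : p.Prime) {S : Finset ι}
    {v : ι → ℂ} (hv : ∀ s ∈ S, v s ^ p ^ e = 1) (hsum : ∑ s ∈ S, v s = 0)
    {s₀ : ι} (hs₀ : s₀ ∈ S) {η : ℂ} (hη : η ^ p = 1) :
    ∃ s ∈ S, v s = η * v s₀ := by
  classical
  set N := p ^ (e + 1) with hN
  have hNpos : 0 < N := pow_pos hp.pos _
  have : NeZero N := ⟨hNpos.ne'⟩
  obtain ⟨ω, hω⟩ : ∃ ω : ℂ, IsPrimitiveRoot ω N := ⟨_, Complex.isPrimitiveRoot_exp N hNpos.ne'⟩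
  have hg : ∀ s, ∃ i : ℕ, s ∈ S → ω ^ i = v s := by
    intro s
    by_cases hs : s ∈ S
    · have h1 : v s ^ N = 1 := by rw [hN, pow_succ, pow_mul, hv s hs, one_pow]
      obtain ⟨i, -, hi⟩ := hω.eq_pow_of_pow_eq_one h1
      exact ⟨i, fun _ => hi⟩
    · exact ⟨0, fun h => absurd h hs⟩
  choose g hg using hg
  have hωp : IsPrimitiveRoot (ω ^ p ^ e) p := hω.pow hNpos (by rw [hN, pow_succ])
  have : NeZero p := ⟨hp.ne_zero⟩
  obtain ⟨j, -, hj⟩ := hωp.eq_pow_of_pow_eq_one hη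
  set F : Polynomial ℤ := ∑ s ∈ S, Polynomial.X ^ g s with hF
  have hF0 : Polynomial.aeval ω F = 0 := by
    rw [hF, map_sum, ← hsum]
    exact Finset.sum_congr rfl fun s hs => by simp [hg s hs]
  have hdvd : Polynomial.cyclotomic N ℤ ∣ F := by
    rw [Polynomial.cyclotomic_eq_minpoly hω hNpos]
    exact minpoly.isIntegrallyClosed_dvd (hω.isIntegral hNpos) hF0
  have hdvd2 : (Polynomial.X ^ N - 1 : Polynomial ℤ) ∣
      (Polynomial.X ^ (p ^ e * j) - 1) * F := by
    have := Fact.mk hp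
    rw [hN, ← Polynomial.cyclotomic_prime_pow_mul_X_pow_sub_one ℤ p e, mul_comm]
    refine mul_dvd_mul ?_ hdvd
    rw [pow_mul]
    exact sub_one_dvd_pow_sub_one _ _
  obtain ⟨Q, hQ⟩ := hdvd2
  -- `ℤ[X] → ℤ[X] / (X ^ N - 1)`, with the quotient realized as the group ring of `ℤ/N`
  let φ : Polynomial ℤ →ₐ[ℤ] AddMonoidAlgebra ℤ (ZMod N) :=
    Polynomial.aeval (AddMonoidAlgebra.single (1 : ZMod N) (1 : ℤ))
  have hφ : ∀ i : ℕ, φ (Polynomial.X ^ i) = AddMonoidAlgebra.single (i : ZMod N) 1 := by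
    intro i
    simp [φ, AddMonoidAlgebra.single_pow]
  have key : φ (Polynomial.X ^ (p ^ e * j)) * φ F = φ F := by
    have h := congrArg φ hQ
    rw [map_mul, map_mul, map_sub, map_sub, map_one, hφ N, ZMod.natCast_self,
      ← AddMonoidAlgebra.one_def, sub_self, zero_mul, sub_mul, one_mul, sub_eq_zero] at h
    exact h
  have hφF : φ F = ∑ s ∈ S, AddMonoidAlgebra.single (g s : ZMod N) (1 : ℤ) := by
    rw [hF, map_sum]; exact Finset.sum_congr rfl fun s _ => hφ _
  rw [hφ, hφF, Finset.mul_sum] at key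
  simp only [AddMonoidAlgebra.single_mul_single, mul_one] at key
  have hc := congrArg (fun f : AddMonoidAlgebra ℤ (ZMod N) =>
    f.coeff (((p ^ e * j : ℕ) : ZMod N) + g s₀)) key
  simp only [AddMonoidAlgebra.coeff_sum, AddMonoidAlgebra.coeff_single, Finsupp.coe_finsetSum,
    Finset.sum_apply] at hc
  have hpos : 0 < ∑ s ∈ S, (Finsupp.single (((p ^ e * j : ℕ) : ZMod N) + g s) (1 : ℤ))
      (((p ^ e * j : ℕ) : ZMod N) + g s₀) := by
    refine Finset.sum_pos' (fun s _ => ?_) ⟨s₀, hs₀, by simp⟩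
    rw [Finsupp.single_apply]; split_ifs <;> simp
  rw [hc] at hpos
  obtain ⟨s, hs, hne⟩ := Finset.exists_ne_zero_of_sum_ne_zero hpos.ne'
  have hgs : (g s : ZMod N) = ((p ^ e * j : ℕ) : ZMod N) + g s₀ := by
    by_contra h
    exact hne (Finsupp.single_eq_of_ne (Ne.symm h))
  refine ⟨s, hs, ?_⟩
  rw [← hg s hs, ← hg s₀ hs₀, ← hj, ← pow_mul, ← pow_add]
  rw [← Nat.cast_add, ZMod.natCast_eq_natCast_iff] at hgs
  exact pow_eq_pow_of_modEq hgs hω.pow_eq_one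

/-- If the products `f a * g b` run through every unit modulo `N` exactly once, then a nontrivial
Dirichlet character sums to zero over one of the two factors. -/
theorem sum_mul_sum_eq_zero_of_factorization {N : ℕ} [NeZero N] {χ : DirichletCharacter ℂ N}
    (hχ : χ ≠ 1) {α β : Type*} {A : Finset α} {B : Finset β} {f : α → ZMod N} {g : β → ZMod N}
    (hf : ∀ a ∈ A, IsUnit (f a)) (hg : ∀ b ∈ B, IsUnit (g b))
    (hinj : ∀ a ∈ A, ∀ b ∈ B, ∀ a' ∈ A, ∀ b' ∈ B, f a * g b = f a' * g b' → a = a' ∧ b = b')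
    (hcard : N.totient ≤ A.card * B.card) :
    (∑ a ∈ A, χ (f a)) * ∑ b ∈ B, χ (g b) = 0 := by
  classical
  set U : Finset (ZMod N) := Finset.univ.filter IsUnit with hU
  have hUcard : U.card = N.totient := by
    rw [← ZMod.card_units_eq_totient, Fintype.card, hU]
    symm
    refine Finset.card_bij (fun u _ => (u : ZMod N)) (fun u _ => by simp)
      (fun u _ v _ h => Units.ext h) fun x hx => ?_
    obtain ⟨u, rfl⟩ := (Finset.mem_filter.1 hx).2
    exact ⟨u, Finset.mem_univ _, rfl⟩
  have hinj' : Set.InjOn (fun x : α × β => f x.1 * g x.2) (A ×ˢ B : Finset (α × β)) := by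
    rintro ⟨a, b⟩ h ⟨a', b'⟩ h' heq
    simp only [Finset.coe_product, Set.mem_prod, Finset.mem_coe] at h h'
    obtain ⟨rfl, rfl⟩ := hinj a h.1 b h.2 a' h'.1 b' h'.2 heq
    rfl
  have himg : (A ×ˢ B).image (fun x : α × β => f x.1 * g x.2) = U := by
    refine Finset.eq_of_subset_of_card_le ?_ ?_
    · intro x hx
      obtain ⟨⟨a, b⟩, h, rfl⟩ := Finset.mem_image.1 hx
      rw [Finset.mem_product] at h
      exact Finset.mem_filter.2 ⟨Finset.mem_univ _, (hf a h.1).mul (hg b h.2)⟩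
    · rw [Finset.card_image_of_injOn hinj', Finset.card_product, hUcard]
      exact hcard
  rw [Finset.sum_mul_sum, ← Finset.sum_product', ← MulChar.sum_eq_zero_of_ne_one hχ]
  calc ∑ x ∈ A ×ˢ B, χ (f x.1) * χ (g x.2) = ∑ x ∈ A ×ˢ B, χ (f x.1 * g x.2) := by
        simp only [map_mul]
    _ = ∑ u ∈ U, χ u := by rw [← himg, Finset.sum_image hinj']
    _ = ∑ u, χ u := Finset.sum_filter_of_ne fun u _ hu => by
        by_contra h
        exact hu (χ.map_nonunit h)

/-! ### Characters modulo odd prime powers -/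

/-- For odd `p` there is a character modulo `p ^ n` whose sum over a nonempty set of units that are
distinct modulo `p ^ (n - 1)` never vanishes. Take a character of order `p ^ (n - 1)`. If the sum
vanished, the set would contain `p` elements whose quotients lie in the kernel of `χ ^ p`; modulo
`p ^ (n - 1)` these quotients are roots of `x ^ (p - 1) = 1`, of which there are only `p - 1`. -/
theorem exists_character_sum_ne_zero_of_odd_prime {p n : ℕ} (hp : p.Prime) (hp2 : p ≠ 2)
    (hn : 2 ≤ n) :
    ∃ χ : DirichletCharacter ℂ (p ^ n), χ ≠ 1 ∧ ∀ {ι : Type} (S : Finset ι)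
      (f : ι → ZMod (p ^ n)), (∀ s ∈ S, IsUnit (f s)) →
      (∀ s ∈ S, ∀ s' ∈ S, ZMod.castHom (pow_dvd_pow p (n.sub_le 1)) (ZMod (p ^ (n - 1))) (f s) =
        ZMod.castHom (pow_dvd_pow p (n.sub_le 1)) (ZMod (p ^ (n - 1))) (f s') → s = s') →
      S.Nonempty → ∑ s ∈ S, χ (f s) ≠ 0 := by
  classical
  obtain ⟨e, rfl⟩ : ∃ e, n = e + 2 := ⟨n - 2, by omega⟩
  have : Fact p.Prime := ⟨hp⟩
  have hcyc := ZMod.isCyclic_units_of_prime_pow p hp hp2 (e + 2)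
  have hcyc1 := ZMod.isCyclic_units_of_prime_pow p hp hp2 (e + 1)
  obtain ⟨γ, hγ⟩ := hcyc.exists_generator
  obtain ⟨ω, hω⟩ : ∃ ω : ℂ, IsPrimitiveRoot ω (p ^ (e + 1)) :=
    ⟨_, Complex.isPrimitiveRoot_exp _ (pow_pos hp.pos _).ne'⟩
  obtain ⟨ζ, rfl⟩ := hω.isUnit (pow_pos hp.pos _).ne'
  have hζ : IsPrimitiveRoot ζ (p ^ (e + 1)) := IsPrimitiveRoot.coe_units_iff.1 hω
  have hζmem : ζ ∈ rootsOfUnity (Fintype.card (ZMod (p ^ (e + 2)))ˣ) ℂ := by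
    rw [mem_rootsOfUnity, ZMod.card_units_eq_totient, Nat.totient_prime_pow_succ hp, pow_mul,
      hζ.pow_eq_one, one_pow]
  set χ : DirichletCharacter ℂ (p ^ (e + 2)) := MulChar.ofRootOfUnity hζmem hγ with hχdef
  have hχγ : χ γ = ζ := MulChar.ofRootOfUnity_spec hζmem hγ
  have hχpow : ∀ j : ℕ, χ ((γ ^ j : (ZMod (p ^ (e + 2)))ˣ) : ZMod (p ^ (e + 2))) = (ζ : ℂ) ^ j := by
    intro j; rw [Units.val_pow_eq_pow_val, map_pow, hχγ]
  have hgen : ∀ u : (ZMod (p ^ (e + 2)))ˣ, ∃ j : ℕ, γ ^ j = u := fun u =>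
    (mem_powers_iff_mem_zpowers.2 (hγ u))
  -- `χ` has `p`-power order, so vanishing sums of its values can be analysed
  have hχe : ∀ u : (ZMod (p ^ (e + 2)))ˣ, χ u ^ p ^ (e + 1) = 1 := by
    intro u
    obtain ⟨j, rfl⟩ := hgen u
    rw [hχpow, ← pow_mul, mul_comm, pow_mul, hω.pow_eq_one, one_pow]
  have hd : p ^ (e + 1) ∣ p ^ (e + 2) := pow_dvd_pow p (by omega)
  have hker : ∀ u : (ZMod (p ^ (e + 2)))ˣ, χ u ^ p = 1 → ZMod.unitsMap hd u ^ (p - 1) = 1 := by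
    intro u hu
    obtain ⟨j, rfl⟩ := hgen u
    rw [hχpow, ← pow_mul, hω.pow_eq_one_iff_dvd, pow_succ] at hu
    obtain ⟨c, rfl⟩ := Nat.dvd_of_mul_dvd_mul_right hp.pos hu
    have h1 : ZMod.unitsMap hd γ ^ (p ^ e * (p - 1)) = 1 := by
      rw [← Nat.totient_prime_pow_succ hp, ← ZMod.card_units_eq_totient, pow_card_eq_one]
    rw [map_pow, ← pow_mul, mul_right_comm, pow_mul, h1, one_pow]
  refine ⟨χ, ?_, ?_⟩
  · intro h1
    have h2 : (ζ : ℂ) = 1 := by rw [← hχγ, h1, MulChar.one_apply_coe]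
    rw [h2] at hω
    have := hω.unique IsPrimitiveRoot.one
    exact (Nat.one_lt_pow (by omega) hp.one_lt).ne' this
  intro ι S f hf hinj ⟨s₀, hs₀⟩ hsum
  have hv : ∀ s ∈ S, χ (f s) ^ p ^ (e + 1) = 1 := by
    intro s hs
    obtain ⟨u, hu⟩ := hf s hs
    rw [← hu, hχe]
  have hex : ∀ η ∈ Polynomial.nthRootsFinset p (1 : ℂ), ∃ s ∈ S, χ (f s) = η * χ (f s₀) :=
    fun η hη => exists_eq_mul_of_sum_eq_zero hp hv hsum hs₀
      ((Polynomial.mem_nthRootsFinset hp.pos 1).1 hη)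
  have : Nonempty ι := ⟨s₀⟩
  -- `σ η` is an element of the set on which `χ` is `η` times its value at `s₀`
  choose! σ hσS hσ using hex
  choose! u hu using hf
  have hχ0 : χ (f s₀) ≠ 0 := by
    intro h; have := hv s₀ hs₀; rw [h, zero_pow (pow_pos hp.pos _).ne'] at this
    exact zero_ne_one this
  have hquot : ∀ η ∈ Polynomial.nthRootsFinset p (1 : ℂ), χ (u (σ η) / u s₀ : (ZMod _)ˣ) = η := by
    intro η hη
    have h1 : χ (u (σ η) / u s₀ : (ZMod _)ˣ) * χ (u s₀) = χ (u (σ η)) := by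
      rw [← map_mul, ← Units.val_mul, div_mul_cancel]
    rw [hu _ hs₀, hu _ (hσS η hη), hσ η hη] at h1
    exact mul_right_cancel₀ hχ0 h1
  have hle : (Polynomial.nthRootsFinset p (1 : ℂ)).card ≤
      (Finset.univ.filter fun x : (ZMod (p ^ (e + 1)))ˣ => x ^ (p - 1) = 1).card := by
    refine Finset.card_le_card_of_injOn (fun η => ZMod.unitsMap hd (u (σ η) / u s₀)) ?_ ?_
    · intro η hη
      refine Finset.mem_coe.2 (Finset.mem_filter.2 ⟨Finset.mem_univ _, hker _ ?_⟩)
      rw [hquot η hη]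
      exact (Polynomial.mem_nthRootsFinset hp.pos 1).1 hη
    · intro η hη η' hη' h
      have h := div_left_injective (by simpa only [map_div] using h)
      have h2 := hinj _ (hσS η hη) _ (hσS η' hη') (by
        rw [← hu _ (hσS η hη), ← hu _ (hσS η' hη')]
        exact congrArg Units.val h)
      rw [← hquot η hη, ← hquot η' hη', h2]
  have hroot := (hω.pow (pow_pos hp.pos _) (pow_succ p e)).card_nthRootsFinset
  rw [hroot] at hle
  have := hle.trans (IsCyclic.card_pow_eq_one_le (α := (ZMod (p ^ (e + 1)))ˣ) (n := p - 1)
    (by have := hp.two_le; omega))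
  have := hp.two_le
  omega

/-! ### Characters modulo powers of two -/

/-- The complex characters of a finite commutative group separate points. Stating it for an abstract
group lets it be applied to a quotient group by unification. -/
theorem exists_complexCharacter_apply_ne_one {Q : Type*} [CommGroup Q] [Finite Q] {a : Q}
    (ha : a ≠ 1) : ∃ ψ : Q →* ℂˣ, ψ a ≠ 1 :=
  CommGroup.exists_apply_ne_one_of_hasEnoughRootsOfUnity Q ℂ ha

/-- There is a character modulo `2 ^ m` with kernel `{1, -1}` and value `-1` at `1 + 2 ^ (m - 1)`.
If it sums to zero over a set of units, then with each `u` the set contains one of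
`u (1 + 2 ^ (m - 1))` and `-u (1 + 2 ^ (m - 1))`. -/
theorem exists_character_two_pow {m : ℕ} (hm : 3 ≤ m) :
    ∃ χ : DirichletCharacter ℂ (2 ^ m), χ ≠ 1 ∧ ∀ {ι : Type} (S : Finset ι)
      (f : ι → ZMod (2 ^ m)), (∀ s ∈ S, IsUnit (f s)) → ∑ s ∈ S, χ (f s) = 0 → ∀ s₀ ∈ S,
      ∃ s ∈ S, f s = f s₀ * (1 + 2 ^ (m - 1)) ∨ f s = -(f s₀ * (1 + 2 ^ (m - 1))) := by
  classical
  obtain ⟨e, rfl⟩ : ∃ e, m = e + 3 := ⟨m - 3, by omega⟩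
  set N := 2 ^ (e + 3) with hN
  have hN0 : (2 : ZMod N) ^ (e + 3) = 0 := by
    have := ZMod.natCast_self N
    rw [hN] at this ⊢
    exact_mod_cast this
  rw [show e + 3 - 1 = e + 2 by omega]
  have hεmul : (1 + 2 ^ (e + 2) : ZMod N) * (1 + 2 ^ (e + 2)) = 1 := by
    linear_combination (1 + 2 ^ (e + 1)) * hN0
  let ε : (ZMod N)ˣ := ⟨1 + 2 ^ (e + 2), 1 + 2 ^ (e + 2), hεmul, hεmul⟩
  have hεmem : ε ∉ Subgroup.zpowers (-1 : (ZMod N)ˣ) := by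
    have hpow : (2 : ℤ) ^ (e + 3) = 4 * (2 * 2 ^ e) ∧ (2 : ℤ) ^ (e + 2) = 4 * 2 ^ e ∧
        (0 : ℤ) < 2 ^ e := ⟨by ring, by ring, by positivity⟩
    rintro ⟨k, hk⟩
    rcases Int.even_or_odd k with h | h
    · have h1 : ((2 ^ (e + 2) : ℤ) : ZMod N) = 0 := by
        have h2 := congrArg Units.val hk
        simp only [h.neg_one_zpow, ε, Units.val_one] at h2
        push_cast
        linear_combination -h2
      rw [ZMod.intCast_zmod_eq_zero_iff_dvd, hN] at h1
      push_cast at h1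
      have := Int.le_of_dvd (by positivity) h1
      omega
    · have h1 : ((2 + 2 ^ (e + 2) : ℤ) : ZMod N) = 0 := by
        have h2 := congrArg Units.val hk
        simp only [h.neg_one_zpow, ε, Units.val_one, Units.val_neg] at h2
        push_cast
        linear_combination -h2
      rw [ZMod.intCast_zmod_eq_zero_iff_dvd, hN] at h1
      push_cast at h1
      rw [hpow.1, hpow.2.1] at h1
      have := dvd_of_mul_right_dvd h1
      omega
  have : NeZero N := ⟨by positivity⟩
  obtain ⟨ψ, hψ⟩ := exists_complexCharacter_apply_ne_one
    (Q := (ZMod N)ˣ ⧸ Subgroup.zpowers (-1 : (ZMod N)ˣ)) (a := QuotientGroup.mk' _ ε)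
    (by rwa [Ne, QuotientGroup.mk'_apply, QuotientGroup.eq_one_iff])
  let χu : (ZMod N)ˣ →* ℂˣ := ψ.comp (QuotientGroup.mk' _)
  have hχneg : χu (-1) = 1 := by
    have : (QuotientGroup.mk' (Subgroup.zpowers (-1 : (ZMod N)ˣ))) (-1) = 1 := by
      rw [QuotientGroup.mk'_apply, QuotientGroup.eq_one_iff]
      exact Subgroup.mem_zpowers _
    simp only [χu, MonoidHom.comp_apply, this, map_one]
  have hχε : χu ε ≠ 1 := hψ
  have hε2 : ε * ε = 1 := Units.ext hεmul
  have hχε' : χu ε = -1 := by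
    have h1 : χu ε * χu ε = 1 := by rw [← map_mul, hε2, map_one]
    have h2 : ((χu ε : ℂˣ) : ℂ) * χu ε = 1 := by rw [← Units.val_mul, h1, Units.val_one]
    rcases mul_self_eq_one_iff.1 h2 with h | h
    · exact absurd (Units.ext h) hχε
    · exact Units.ext h
  -- A unit `x ≡ 1` modulo `4` other than `1` has a power equal to `ε`, where the character is not
  -- `1`; so the character is injective on the units that are `1` modulo `4`.
  have hker4 : ∀ (x : (ZMod N)ˣ) (a : ℤ), (x : ZMod N) = ((1 + 4 * a : ℤ) : ZMod N) →
      χu x = 1 → x = 1 := by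
    intro x a hx h1
    by_contra hne
    have h4 : ¬ (2 : ℤ) ^ (e + 3) ∣ 4 * a := by
      intro h
      apply hne
      have h0 : ((4 * a : ℤ) : ZMod N) = 0 := by
        rw [ZMod.intCast_zmod_eq_zero_iff_dvd, hN]
        exact_mod_cast h
      rw [Int.cast_add, h0] at hx
      exact Units.ext (by simpa using hx)
    have ha : 4 * a ≠ 0 := by
      intro h; exact h4 (h ▸ dvd_zero _)
    obtain ⟨c, hvc, hc⟩ := (Int.finiteMultiplicity_iff (a := 2).2
      ⟨by norm_num, ha⟩).exists_eq_pow_mul_and_not_dvd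
    set v := multiplicity 2 (4 * a)
    have hv : v < e + 3 := by
      by_contra hv
      exact h4 (hvc ▸ (pow_dvd_pow 2 (not_lt.1 hv)).mul_right c)
    have hv2 : 2 ≤ v := by
      by_contra hv
      have : v = 0 ∨ v = 1 := by omega
      rcases this with h | h <;> rw [h] at hvc <;> omega
    obtain ⟨y, hy⟩ := ZMod.exists_one_add_mul_pow_prime_pow_eq (R := ℤ) (u := 2 ^ v) (v := 2)
      Nat.prime_two (dvd_pow_self 2 (by omega)) (by
        push_cast
        rw [← pow_mul, ← pow_succ', ← pow_succ]
        exact pow_dvd_pow 2 (by omega)) c (e + 2 - v)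
    obtain ⟨d, hd⟩ : ∃ d, c = 2 * d + 1 := ⟨c / 2, by omega⟩
    have hxε : x ^ 2 ^ (e + 2 - v) = ε := by
      apply Units.ext
      have h1 : (2 : ℤ) ^ (e + 2 - v) * 2 ^ v = 2 ^ (e + 2) := by
        rw [← pow_add]; congr 1; omega
      push_cast at hy
      rw [← hvc, h1, hd] at hy
      rw [Units.val_pow_eq_pow_val, hx, ← Int.cast_pow, hy]
      simp only [ε]
      push_cast
      linear_combination ((d : ZMod N) + y) * hN0
    exact hχε (by rw [← hxε, map_pow, h1, one_pow])
  have hker : ∀ x : (ZMod N)ˣ, χu x = 1 → x = 1 ∨ x = -1 := by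
    intro x hx
    have hodd : Nat.Coprime (x : ZMod N).val N := ZMod.val_coe_unit_coprime x
    have hodd : (x : ZMod N).val % 2 = 1 :=
      Nat.odd_iff.1 (Nat.coprime_two_right.1
        (Nat.Coprime.coprime_dvd_right (dvd_pow_self 2 (by omega)) hodd))
    have hval : (((x : ZMod N).val : ℤ) : ZMod N) = x := by simp
    rcases (by omega : (x : ZMod N).val % 4 = 1 ∨ (x : ZMod N).val % 4 = 3) with h | h
    · left
      refine hker4 x (((x : ZMod N).val : ℤ) / 4) ?_ hx
      rw [show 1 + 4 * (((x : ZMod N).val : ℤ) / 4) = ((x : ZMod N).val : ℤ) by omega, hval]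
    · right
      have h1 : -x = 1 := by
        refine hker4 (-x) ((-((x : ZMod N).val : ℤ)) / 4) ?_ ?_
        · rw [show 1 + 4 * ((-((x : ZMod N).val : ℤ)) / 4) = -((x : ZMod N).val : ℤ) by omega,
            Int.cast_neg, hval, Units.val_neg]
        · rw [← neg_one_mul, map_mul, hχneg, hx, one_mul]
      rw [← h1, neg_neg]
  refine ⟨MulChar.ofUnitHom χu, ?_, ?_⟩
  · intro h
    have h1 : (MulChar.ofUnitHom χu : DirichletCharacter ℂ N) ε = 1 := by
      rw [h, MulChar.one_apply_coe]
    rw [MulChar.ofUnitHom_coe] at h1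
    exact hχε (Units.ext h1)
  intro ι S f hf hsum s₀ hs₀
  have hv : ∀ s ∈ S, (MulChar.ofUnitHom χu : DirichletCharacter ℂ N) (f s) ^ 2 ^ (e + 2) = 1 := by
    intro s hs
    obtain ⟨u, hu⟩ := hf s hs
    have h1 : Fintype.card (ZMod N)ˣ = 2 ^ (e + 2) := by
      rw [ZMod.card_units_eq_totient, hN, Nat.totient_prime_pow_succ Nat.prime_two]; simp
    rw [← hu, ← map_pow, ← Units.val_pow_eq_pow_val, ← h1, pow_card_eq_one, Units.val_one, map_one]
  obtain ⟨s, hs, h⟩ := exists_eq_mul_of_sum_eq_zero (η := -1) Nat.prime_two hv hsum hs₀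
    (by norm_num)
  refine ⟨s, hs, ?_⟩
  obtain ⟨u, hu⟩ := hf s hs
  obtain ⟨u₀, hu₀⟩ := hf s₀ hs₀
  rw [← hu, ← hu₀, MulChar.ofUnitHom_coe, MulChar.ofUnitHom_coe] at h
  have h2 : χu u = χu ε * χu u₀ := by
    rw [hχε']; exact Units.ext (by simpa using h)
  have h3 : χu (u / (u₀ * ε)) = 1 := by
    rw [map_div, map_mul, h2, mul_comm, div_self']
  rw [← hu, ← hu₀]
  rcases hker _ h3 with h4 | h4
  · left
    rw [div_eq_one] at h4
    rw [h4]; rfl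
  · right
    rw [div_eq_iff_eq_mul] at h4
    rw [h4]; simp [ε]

/-! ### Splitter sets and multipliers -/

theorem mem_splitterMultipliers {k₁ k₂ : ℕ} {a : ℤ} :
    a ∈ splitterMultipliers k₁ k₂ ↔ a ≠ 0 ∧ -(k₁ : ℤ) ≤ a ∧ a ≤ k₂ := by
  simp [splitterMultipliers]

theorem card_splitterMultipliers (k₁ k₂ : ℕ) : (splitterMultipliers k₁ k₂).card = k₁ + k₂ := by
  rw [splitterMultipliers, Finset.card_erase_of_mem (by simp), Int.card_Icc]
  omega

theorem IsSplitterSet.eq_of_mul_eq {k₁ k₂ q : ℕ} {B : Finset (ZMod q)}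
    (h : IsSplitterSet k₁ k₂ q B) {a a' : ℤ} {b b' : ZMod q}
    (ha : a ∈ splitterMultipliers k₁ k₂) (ha' : a' ∈ splitterMultipliers k₁ k₂)
    (hb : b ∈ B) (hb' : b' ∈ B) (heq : (a : ZMod q) * b = a' * b') : a = a' ∧ b = b' := by
  have hmem : (a : ZMod q) * b ∈ splitterBlock k₁ k₂ q b := Finset.mem_image_of_mem _ ha
  have hmem' : (a' : ZMod q) * b' ∈ splitterBlock k₁ k₂ q b' := Finset.mem_image_of_mem _ ha'
  obtain rfl : b = b' := by
    by_contra hne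
    exact Finset.disjoint_left.1 (h.disjoint_blocks b hb b' hb' hne) hmem (heq ▸ hmem')
  refine ⟨?_, rfl⟩
  have hcard := h.card_block b hb
  rw [← card_splitterMultipliers, splitterBlock, Finset.card_image_iff] at hcard
  exact hcard ha ha' heq

/-- A perfect splitter set splits all of `ℤ/q \ {0}`: its blocks have `q - 1` elements in total. -/
theorem IsPerfectSplitterSet.exists_mul_eq {k₁ k₂ q : ℕ} [NeZero q] {B : Finset (ZMod q)}
    (h : IsPerfectSplitterSet k₁ k₂ q B) {x : ZMod q} (hx : x ≠ 0) :
    ∃ a ∈ splitterMultipliers k₁ k₂, ∃ b ∈ B, (a : ZMod q) * b = x := by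
  have hU : B.biUnion (splitterBlock k₁ k₂ q) = Finset.univ.erase 0 := by
    refine Finset.eq_of_subset_of_card_le ?_ ?_
    · intro y hy
      obtain ⟨b, hb, hy⟩ := Finset.mem_biUnion.1 hy
      refine Finset.mem_erase.2 ⟨?_, Finset.mem_univ _⟩
      rintro rfl
      exact h.isSplitterSet.zero_notMem b hb hy
    · rw [Finset.card_biUnion h.isSplitterSet.disjoint_blocks,
        Finset.sum_congr rfl h.isSplitterSet.card_block, Finset.sum_const, smul_eq_mul,
        Finset.card_erase_of_mem (Finset.mem_univ _), Finset.card_univ, ZMod.card]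
      have := h.card_eq
      rw [mul_comm] at this
      omega
  have hx' : x ∈ B.biUnion (splitterBlock k₁ k₂ q) := by simp [hU, hx]
  obtain ⟨b, hb, hxb⟩ := Finset.mem_biUnion.1 hx'
  obtain ⟨a, ha, rfl⟩ := Finset.mem_image.1 hxb
  exact ⟨a, ha, b, hb, rfl⟩

theorem ZMod.isUnit_intCast_prime_pow {p n : ℕ} (hp : p.Prime) {a : ℤ} (ha : ¬ (p : ℤ) ∣ a) :
    IsUnit (a : ZMod (p ^ n)) := by
  rw [ZMod.coe_int_isUnit_iff_isCoprime]
  push_cast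
  exact ((Nat.prime_iff_prime_int.1 hp).coprime_iff_not_dvd.2 ha).pow_left

theorem ZMod.not_isUnit_intCast_prime_pow {p n : ℕ} (hp : p.Prime) (hn : n ≠ 0) {a : ℤ}
    (ha : (p : ℤ) ∣ a) : ¬ IsUnit (a : ZMod (p ^ n)) := by
  rw [ZMod.coe_int_isUnit_iff_isCoprime]
  push_cast
  intro h
  exact (Nat.prime_iff_prime_int.1 hp).not_isUnit (h.isUnit_of_dvd' (dvd_pow_self _ hn) ha)

/-- The units modulo `p ^ n` factor uniquely as a multiplier prime to `p` times a unit of `B`. -/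
theorem IsPerfectSplitterSet.card_mul_card_units {k₁ k₂ p n : ℕ} (hp : p.Prime) (hn : n ≠ 0)
    {B : Finset (ZMod (p ^ n))} (h : IsPerfectSplitterSet k₁ k₂ (p ^ n) B)
    [DecidablePred (IsUnit : ZMod (p ^ n) → Prop)] :
    ((splitterMultipliers k₁ k₂).filter fun a => ¬ (p : ℤ) ∣ a).card * (B.filter IsUnit).card =
      (p ^ n).totient := by
  have : NeZero (p ^ n) := ⟨(pow_pos hp.pos _).ne'⟩
  rw [← ZMod.card_units_eq_totient, ← Finset.card_univ, ← Finset.card_product]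
  have hunit : ∀ x ∈ ((splitterMultipliers k₁ k₂).filter fun a => ¬ (p : ℤ) ∣ a) ×ˢ B.filter IsUnit,
      IsUnit ((x.1 : ZMod (p ^ n)) * x.2) := by
    intro x hx
    simp only [Finset.mem_product, Finset.mem_filter] at hx
    exact (ZMod.isUnit_intCast_prime_pow hp hx.1.2).mul hx.2.2
  refine Finset.card_bij (fun x hx => (hunit x hx).unit) (fun _ _ => Finset.mem_univ _) ?_ ?_
  · rintro ⟨a, b⟩ hx ⟨a', b'⟩ hx' heq
    have heq := congrArg Units.val heq
    simp only [Finset.mem_product, Finset.mem_filter, IsUnit.unit_spec] at hx hx' heq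
    obtain ⟨rfl, rfl⟩ := h.isSplitterSet.eq_of_mul_eq hx.1.1 hx'.1.1 hx.2.1 hx'.2.1 heq
    rfl
  · intro u _
    have : Nontrivial (ZMod (p ^ n)) :=
      have : Fact (1 < p ^ n) := ⟨Nat.one_lt_pow hn hp.one_lt⟩
      inferInstance
    obtain ⟨a, ha, b, hb, hab⟩ := h.exists_mul_eq u.ne_zero
    have hu := u.isUnit
    rw [← hab, IsUnit.mul_iff] at hu
    refine ⟨(a, b), ?_, Units.ext hab⟩
    simp only [Finset.mem_product, Finset.mem_filter]
    exact ⟨⟨ha, fun hd => ZMod.not_isUnit_intCast_prime_pow hp hn hd hu.1⟩, hb, hu.2⟩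

theorem card_filter_dvd_Icc {k₁ k₂ d : ℕ} (hd : d ∣ k₁ + k₂ + 1) :
    ((Finset.Icc (-(k₁ : ℤ)) k₂).filter fun a => (d : ℤ) ∣ a).card * d = k₁ + k₂ + 1 := by
  obtain ⟨u, hu⟩ := hd
  have hd0 : 0 < d := by
    rcases Nat.eq_zero_or_pos d with rfl | h
    · simp at hu
    · exact h
  have hI : Finset.Icc (-(k₁ : ℤ)) k₂ = Finset.Ico (-(k₁ : ℤ)) (-k₁ + d * u) := by
    ext x
    simp only [Finset.mem_Icc, Finset.mem_Ico]
    have : (k₁ : ℤ) + k₂ + 1 = d * u := by exact_mod_cast hu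
    rw [← this]
    omega
  have hcard := Int.Ico_filter_dvd_card (-(k₁ : ℤ)) (-k₁ + d * u) (r := d) (by exact_mod_cast hd0)
  have hd' : ((d : ℤ) : ℚ) ≠ 0 := by exact_mod_cast hd0.ne'
  have hq : ((-k₁ + d * u : ℤ) : ℚ) / ((d : ℤ) : ℚ) =
      ((-k₁ : ℤ) : ℚ) / ((d : ℤ) : ℚ) + (u : ℤ) := by
    push_cast at hd' ⊢
    field_simp
  rw [← hI, hq, Int.ceil_add_intCast, add_sub_cancel_left, max_eq_left (by positivity)] at hcard
  have : ((Finset.Icc (-(k₁ : ℤ)) k₂).filter fun a => (d : ℤ) ∣ a).card = u := by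
    exact_mod_cast hcard
  rw [this, hu, mul_comm]

theorem filter_not_dvd_splitterMultipliers {k₁ k₂ d : ℕ} :
    ((splitterMultipliers k₁ k₂).filter fun a => ¬ (d : ℤ) ∣ a) =
      (Finset.Icc (-(k₁ : ℤ)) k₂).filter fun a => ¬ (d : ℤ) ∣ a := by
  ext a
  simp only [splitterMultipliers, Finset.mem_filter, Finset.mem_erase]
  constructor
  · rintro ⟨⟨-, h⟩, h'⟩
    exact ⟨h, h'⟩
  · rintro ⟨h, h'⟩
    exact ⟨⟨fun h0 => h' (h0 ▸ dvd_zero _), h⟩, h'⟩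

theorem card_filter_not_dvd_splitterMultipliers {k₁ k₂ d u : ℕ} (hd : 0 < d)
    (hu : k₁ + k₂ + 1 = d * u) :
    ((splitterMultipliers k₁ k₂).filter fun a => ¬ (d : ℤ) ∣ a).card = u * (d - 1) := by
  rw [filter_not_dvd_splitterMultipliers]
  have h1 := card_filter_dvd_Icc (k₁ := k₁) (k₂ := k₂) (Dvd.intro u hu.symm)
  have h2 := Finset.card_filter_add_card_filter_not (s := Finset.Icc (-(k₁ : ℤ)) k₂)
    (fun a => (d : ℤ) ∣ a)
  rw [hu, mul_comm d, Nat.mul_left_inj hd.ne'] at h1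
  rw [h1, Int.card_Icc] at h2
  obtain ⟨c, rfl⟩ : ∃ c, d = c + 1 := ⟨d - 1, by omega⟩
  have h3 : (((k₂ : ℤ) + 1 - -(k₁ : ℤ)).toNat) = (c + 1) * u := by omega
  rw [h3] at h2
  simp only [Nat.add_sub_cancel]
  nlinarith

/-- Counting units shows that `(k₁ + k₂ + 1) / p` is a power of `p`, so that `k₁ + k₂ + 1 = p ^ t`;
then `p ^ t - 1 ∣ p ^ n - 1` forces `t ∣ n`. The last conjunct says that `B` has `p ^ (n - t)`
units. -/
theorem IsPerfectSplitterSet.exists_exponent {k₁ k₂ p n : ℕ} (hp : p.Prime) (hn : n ≠ 0)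
    (hdvd : p ∣ k₁ + k₂ + 1) (hne : p ≠ k₁ + k₂ + 1) {B : Finset (ZMod (p ^ n))}
    (h : IsPerfectSplitterSet k₁ k₂ (p ^ n) B)
    [DecidablePred (IsUnit : ZMod (p ^ n) → Prop)] :
    ∃ t, 2 ≤ t ∧ t ∣ n ∧ k₁ + k₂ + 1 = p ^ t ∧
      p ^ (t - 1) * (B.filter IsUnit).card = p ^ (n - 1) := by
  obtain ⟨u, hu⟩ := hdvd
  have h1 := h.card_mul_card_units hp hn
  rw [card_filter_not_dvd_splitterMultipliers hp.pos hu, Nat.totient_prime_pow hp (by omega),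
    mul_right_comm, Nat.mul_left_inj (by have := hp.two_le; omega)] at h1
  obtain ⟨j, hj, rfl⟩ := (Nat.dvd_prime_pow hp).1 (Dvd.intro _ h1)
  have hj0 : j ≠ 0 := by
    rintro rfl
    exact hne (by simpa using hu.symm)
  refine ⟨j + 1, by omega, ?_, by rw [hu, pow_succ'], h1⟩
  have hmod := Nat.pow_sub_one_mod_pow_sub_one p (j + 1) n
  have hk : p ^ (j + 1) - 1 = k₁ + k₂ := by rw [pow_succ', ← hu]; simp
  have hd : (p ^ n - 1) % (p ^ (j + 1) - 1) = 0 := by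
    rw [hk, ← h.card_eq, Nat.add_sub_cancel]
    exact Nat.mul_mod_right _ _
  rw [hmod] at hd
  have hpos : 0 < p ^ (n % (j + 1)) := pow_pos hp.pos _
  have h1 : p ^ (n % (j + 1)) = 1 := by omega
  exact Nat.dvd_of_mod_eq_zero ((Nat.pow_eq_one.1 h1).resolve_left hp.one_lt.ne')

/-- Elements of a splitter set are distinct modulo `p ^ (n - i)`, because `p ^ i` or `-p ^ i` is a
multiplier. -/
theorem IsSplitterSet.intCast_eq_of_dvd_sub {k₁ k₂ p n i : ℕ} (hp : 0 < p)
    {B : Finset (ZMod (p ^ n))}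
    (h : IsSplitterSet k₁ k₂ (p ^ n) B) (hi : i ≤ n) (hpi : 2 * p ^ i ≤ k₁ + k₂ + 1)
    {x y : ℤ} (hx : (x : ZMod (p ^ n)) ∈ B) (hy : (y : ZMod (p ^ n)) ∈ B)
    (hxy : (p : ℤ) ^ (n - i) ∣ x - y) : (x : ZMod (p ^ n)) = y := by
  have hpos : 0 < p ^ i := pow_pos hp i
  have hmul : ((p ^ i : ℤ) : ZMod (p ^ n)) * x = ((p ^ i : ℤ) : ZMod (p ^ n)) * y := by
    rw [eq_comm, ← Int.cast_mul, ← Int.cast_mul, ZMod.intCast_eq_intCast_iff_dvd_sub, ← mul_sub]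
    have := mul_dvd_mul_left ((p : ℤ) ^ i) hxy
    push_cast
    rwa [← pow_add, Nat.add_sub_cancel' hi] at this
  have hcast : ((p ^ i : ℕ) : ℤ) = (p : ℤ) ^ i := by push_cast; rfl
  rcases (by omega : p ^ i ≤ k₂ ∨ p ^ i ≤ k₁) with hle | hle
  · have ha : (p ^ i : ℤ) ∈ splitterMultipliers k₁ k₂ := by
      rw [mem_splitterMultipliers, ← hcast]; omega
    exact (h.eq_of_mul_eq ha ha hx hy hmul).2
  · have ha : -(p ^ i : ℤ) ∈ splitterMultipliers k₁ k₂ := by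
      rw [mem_splitterMultipliers, ← hcast]; omega
    exact (h.eq_of_mul_eq ha ha hx hy (by rw [Int.cast_neg, neg_mul, neg_mul, hmul])).2

/-! ### Refutation of larger moduli -/

/-- For odd `p` and `t < n`, both factors of the group of units consist of elements that are
distinct modulo `p ^ (n - 1)`, so a suitable character has nonzero sums over both. -/
theorem IsPerfectSplitterSet.false_of_odd_prime {k₁ k₂ p n t : ℕ} (hp : p.Prime) (hp2 : p ≠ 2)
    (ht : 2 ≤ t) (htn : t < n) (hk : k₁ + k₂ + 1 = p ^ t) {B : Finset (ZMod (p ^ n))}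
    (h : IsPerfectSplitterSet k₁ k₂ (p ^ n) B)
    [DecidablePred (IsUnit : ZMod (p ^ n) → Prop)]
    (hB : (B.filter IsUnit).Nonempty) : False := by
  have hpos := hp.two_le
  have : NeZero (p ^ n) := ⟨(pow_pos hp.pos _).ne'⟩
  obtain ⟨χ, hχ, hsum⟩ := exists_character_sum_ne_zero_of_odd_prime hp hp2 (n := n) (by omega)
  set A := (splitterMultipliers k₁ k₂).filter fun a => ¬ (p : ℤ) ∣ a with hA
  have hzero := sum_mul_sum_eq_zero_of_factorization hχ (A := A) (B := B.filter IsUnit)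
    (f := fun a => (a : ZMod (p ^ n))) (g := id)
    (fun a ha => ZMod.isUnit_intCast_prime_pow hp (Finset.mem_filter.1 ha).2)
    (fun b hb => (Finset.mem_filter.1 hb).2)
    (fun a ha b hb a' ha' b' hb' heq => h.isSplitterSet.eq_of_mul_eq (Finset.mem_filter.1 ha).1
      (Finset.mem_filter.1 ha').1 (Finset.mem_filter.1 hb).1 (Finset.mem_filter.1 hb').1 heq)
    (h.card_mul_card_units hp (by omega)).ge
  have hkZ : (k₁ : ℤ) + k₂ + 1 = (p : ℤ) ^ t := by exact_mod_cast hk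
  rcases mul_eq_zero.1 hzero with h0 | h0
  · refine hsum A _ (fun a ha => ZMod.isUnit_intCast_prime_pow hp (Finset.mem_filter.1 ha).2)
      (fun a ha a' ha' heq => ?_) ?_ h0
    · have h1 := mem_splitterMultipliers.1 (Finset.mem_filter.1 ha).1
      have h2 := mem_splitterMultipliers.1 (Finset.mem_filter.1 ha').1
      rw [map_intCast, map_intCast, ZMod.intCast_eq_intCast_iff_dvd_sub] at heq
      push_cast at heq
      have hle : (p : ℤ) ^ t ≤ (p : ℤ) ^ (n - 1) :=
        pow_le_pow_right₀ (by exact_mod_cast hp.one_le) (by omega)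
      have := Int.eq_zero_of_abs_lt_dvd heq (by rw [abs_lt]; omega)
      omega
    · rw [← Finset.card_pos]
      obtain ⟨u, hu⟩ : p ∣ k₁ + k₂ + 1 := hk ▸ dvd_pow_self p (by omega)
      rw [hA, card_filter_not_dvd_splitterMultipliers hp.pos hu]
      exact Nat.mul_pos (Nat.pos_of_ne_zero (by rintro rfl; simp at hu)) (by omega)
  · refine hsum (B.filter IsUnit) _ (fun b hb => (Finset.mem_filter.1 hb).2)
      (fun b hb b' hb' heq => ?_) hB h0
    have hb := (Finset.mem_filter.1 hb).1
    have hb' := (Finset.mem_filter.1 hb').1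
    obtain ⟨x, rfl⟩ := ZMod.intCast_surjective b
    obtain ⟨y, rfl⟩ := ZMod.intCast_surjective b'
    rw [eq_comm, map_intCast, map_intCast, ZMod.intCast_eq_intCast_iff_dvd_sub] at heq
    push_cast at heq
    refine h.isSplitterSet.intCast_eq_of_dvd_sub hp.pos (i := 1) (by omega) ?_ hb hb' heq
    rw [hk, pow_one]
    calc 2 * p ≤ p * p := Nat.mul_le_mul_right _ hpos
      _ = p ^ 2 := (sq p).symm
      _ ≤ p ^ t := Nat.pow_le_pow_right hp.pos ht

/-- Multipliers with exact `2`-adic valuation `i`, divided by `2 ^ i`, together with the units of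
`B` factor the group of units modulo `2 ^ (n - i)`. The character sum over the multipliers is
nonzero, because they are too small to differ by a factor `±(1 + 2 ^ (n - i - 1))`; so the sum over `B`
vanishes, which yields the stated partner of each unit of `B`. -/
theorem IsSplitterSet.exists_unit_dvd_two_pow {k₁ k₂ n t i : ℕ} (hit : i < t)
    (hitn : t + 2 + i ≤ n) (hk : k₁ + k₂ + 1 = 2 ^ t) {B : Finset (ZMod (2 ^ n))}
    (h : IsSplitterSet k₁ k₂ (2 ^ n) B) [DecidablePred (IsUnit : ZMod (2 ^ n) → Prop)]
    (hB : 2 ^ (t - 1) * (B.filter IsUnit).card = 2 ^ (n - 1)) {x : ℤ}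
    (hx : (x : ZMod (2 ^ n)) ∈ B.filter IsUnit) :
    ∃ y : ℤ, (y : ZMod (2 ^ n)) ∈ B.filter IsUnit ∧
      ((2 : ℤ) ^ (n - i) ∣ y - x * (1 + 2 ^ (n - i - 1)) ∨
        (2 : ℤ) ^ (n - i) ∣ y + x * (1 + 2 ^ (n - i - 1))) := by
  have : NeZero (2 ^ n) := ⟨by positivity⟩
  obtain ⟨χ, hχ, hsum⟩ := exists_character_two_pow (m := n - i) (by omega)
  set A := ((Finset.Icc (-(k₁ : ℤ)) k₂).filter fun a => ((2 ^ i : ℕ) : ℤ) ∣ a).filter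
    fun a => ¬ ((2 ^ (i + 1) : ℕ) : ℤ) ∣ a with hA
  let c := ZMod.castHom (pow_dvd_pow 2 (n.sub_le i)) (ZMod (2 ^ (n - i)))
  have hAmem : ∀ a ∈ A, a ∈ splitterMultipliers k₁ k₂ ∧ ∃ d : ℤ, a = 2 ^ i * d ∧ a / 2 ^ i = d ∧
      ¬ (2 : ℤ) ∣ d ∧ |d| < 2 ^ t := by
    intro a ha
    simp only [hA, Finset.mem_filter, Finset.mem_Icc] at ha
    obtain ⟨⟨ha, d, rfl⟩, hd⟩ := ha
    push_cast at ha hd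
    have h2i : (0 : ℤ) < 2 ^ i := by positivity
    have hd2 : ¬ (2 : ℤ) ∣ d := by
      intro h2
      exact hd (by rw [pow_succ]; exact mul_dvd_mul_left _ h2)
    refine ⟨mem_splitterMultipliers.2 ⟨?_, ha⟩, d, rfl, Int.mul_ediv_cancel_left _ h2i.ne', hd2, ?_⟩
    · intro h0
      push_cast at h0
      rw [h0] at hd
      exact hd (dvd_zero _)
    · have hkZ : (k₁ : ℤ) + k₂ + 1 = 2 ^ t := by exact_mod_cast hk
      have h1 : |(2 : ℤ) ^ i * d| < 2 ^ t := by rw [abs_lt]; omega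
      refine lt_of_le_of_lt ?_ h1
      rw [abs_mul, abs_of_pos h2i]
      exact le_mul_of_one_le_left (abs_nonneg _) h2i
  have hAcard : A.card = 2 ^ (t - i - 1) := by
    have h1 := card_filter_dvd_Icc (k₁ := k₁) (k₂ := k₂) (d := 2 ^ i)
      (hk ▸ pow_dvd_pow 2 (by omega))
    have h2 := card_filter_dvd_Icc (k₁ := k₁) (k₂ := k₂) (d := 2 ^ (i + 1))
      (hk ▸ pow_dvd_pow 2 (by omega))
    have h3 := Finset.card_filter_add_card_filter_not
      (s := (Finset.Icc (-(k₁ : ℤ)) k₂).filter fun a => ((2 ^ i : ℕ) : ℤ) ∣ a)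
      (fun a => ((2 ^ (i + 1) : ℕ) : ℤ) ∣ a)
    rw [← hA, Finset.filter_filter] at h3
    have h4 : ((Finset.Icc (-(k₁ : ℤ)) k₂).filter fun a => ((2 ^ i : ℕ) : ℤ) ∣ a ∧
        ((2 ^ (i + 1) : ℕ) : ℤ) ∣ a) =
        (Finset.Icc (-(k₁ : ℤ)) k₂).filter fun a => ((2 ^ (i + 1) : ℕ) : ℤ) ∣ a := by
      refine Finset.filter_congr fun a _ => ⟨And.right, fun h => ⟨?_, h⟩⟩
      exact (Int.natCast_dvd_natCast.2 (pow_dvd_pow 2 (by omega))).trans h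
    rw [h4] at h3
    have h5 : 2 ^ t = 2 ^ (t - i - 1) * 2 * 2 ^ i := by
      rw [← pow_succ, ← pow_add]; congr 1; omega
    rw [hk, h5] at h1 h2
    have h1 := Nat.eq_of_mul_eq_mul_right (by positivity) h1
    rw [pow_succ', ← mul_assoc, mul_assoc (2 ^ (t - i - 1))] at h2
    have h2 : _ * 2 = 2 ^ (t - i - 1) * 2 := Nat.eq_of_mul_eq_mul_right (by positivity)
      (h2.trans (mul_assoc _ _ _).symm)
    rw [pow_succ'] at h3
    omega
  have hAunit : ∀ a ∈ A, IsUnit ((a / 2 ^ i : ℤ) : ZMod (2 ^ (n - i))) := by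
    intro a ha
    obtain ⟨-, d, -, hd, hd2, -⟩ := hAmem a ha
    rw [hd]
    exact ZMod.isUnit_intCast_prime_pow Nat.prime_two hd2
  have hBunit : ∀ b ∈ B.filter IsUnit, IsUnit (c b) := fun b hb =>
    (Finset.mem_filter.1 hb).2.map c
  -- `2 ^ i * (a / 2 ^ i) = a` for `a ∈ A`, so an equation modulo `2 ^ (n - i)` lifts to one
  -- modulo `2 ^ n` between elements of blocks
  have hzero := sum_mul_sum_eq_zero_of_factorization hχ hAunit hBunit (by
    intro a ha b hb a' ha' b' hb' heq
    obtain ⟨hmem, d, had, hd, -⟩ := hAmem a ha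
    obtain ⟨hmem', d', had', hd', -⟩ := hAmem a' ha'
    refine h.eq_of_mul_eq hmem hmem' (Finset.mem_filter.1 hb).1 (Finset.mem_filter.1 hb').1 ?_
    obtain ⟨x, rfl⟩ := ZMod.intCast_surjective b
    obtain ⟨y, rfl⟩ := ZMod.intCast_surjective b'
    simp only [c] at heq
    rw [hd, hd', map_intCast, map_intCast, ← Int.cast_mul, ← Int.cast_mul,
      ZMod.intCast_eq_intCast_iff_dvd_sub] at heq
    rw [← Int.cast_mul, ← Int.cast_mul, ZMod.intCast_eq_intCast_iff_dvd_sub, had, had']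
    have := mul_dvd_mul_left ((2 : ℤ) ^ i) heq
    push_cast at this ⊢
    rw [← pow_add, Nat.add_sub_cancel' (by omega)] at this
    rwa [mul_assoc, mul_assoc, ← mul_sub]) (by
    rw [hAcard, Nat.totient_prime_pow Nat.prime_two (by omega)]
    have h1 : 2 ^ (t - i - 1) * 2 ^ i = 2 ^ (t - 1) := by rw [← pow_add]; congr 1; omega
    have h2 : 2 ^ (n - i - 1) * 2 ^ i = 2 ^ (n - 1) := by rw [← pow_add]; congr 1; omega
    rw [← h1, ← h2, mul_right_comm] at hB
    rw [Nat.eq_of_mul_eq_mul_right (by positivity) hB]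
    simp)
  rcases mul_eq_zero.1 hzero with h0 | h0
  · exfalso
    obtain ⟨a₀, ha₀⟩ : A.Nonempty := by rw [← Finset.card_pos, hAcard]; positivity
    obtain ⟨a, ha, h1⟩ := hsum A _ hAunit h0 a₀ ha₀
    obtain ⟨-, d₀, -, hd₀, hodd, hlt₀⟩ := hAmem a₀ ha₀
    obtain ⟨-, d, -, hd, -, hlt⟩ := hAmem a ha
    obtain ⟨m, hm⟩ : ∃ m, n - i = m + 1 := ⟨n - i - 1, by omega⟩
    rw [hd, hd₀, hm, Nat.add_sub_cancel] at h1
    have hle : (2 : ℤ) ^ t * 2 ≤ 2 ^ m := by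
      rw [← pow_succ]; exact pow_le_pow_right₀ (by norm_num) (by omega)
    rw [abs_lt] at hlt hlt₀
    have hpm : (0 : ℤ) < 2 ^ m := by positivity
    -- here `z = d₀ ∓ d`: it is divisible by `2 ^ m` and too small, so it is zero, and `d₀` is even
    have hfin : ∀ z : ℤ, |z| < 2 ^ m → ¬ (2 : ℤ) ^ (m + 1) ∣ z + 2 ^ m * d₀ := by
      intro z hz hdvd
      rw [pow_succ] at hdvd
      have hz0 : z = 0 := Int.eq_zero_of_abs_lt_dvd
        ((dvd_add_left (Dvd.intro _ rfl)).1 (dvd_of_mul_right_dvd hdvd)) hz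
      rw [hz0, zero_add, mul_dvd_mul_iff_left hpm.ne'] at hdvd
      exact hodd hdvd
    rcases h1 with h1 | h1
    · have h2 : ((d : ℤ) : ZMod (2 ^ (m + 1))) = ((d₀ * (1 + 2 ^ m) : ℤ) : ZMod (2 ^ (m + 1))) := by
        push_cast
        exact h1
      rw [ZMod.intCast_eq_intCast_iff_dvd_sub] at h2
      refine hfin (d₀ - d) (by rw [abs_lt]; omega) ?_
      push_cast at h2
      convert h2 using 1
      ring
    · have h2 : ((-d : ℤ) : ZMod (2 ^ (m + 1))) =
          ((d₀ * (1 + 2 ^ m) : ℤ) : ZMod (2 ^ (m + 1))) := by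
        push_cast
        rw [h1, neg_neg]
      rw [ZMod.intCast_eq_intCast_iff_dvd_sub] at h2
      refine hfin (d₀ + d) (by rw [abs_lt]; omega) ?_
      push_cast at h2
      convert h2 using 1
      ring
  · obtain ⟨b, hb, h1⟩ := hsum _ _ hBunit h0 _ hx
    obtain ⟨y, rfl⟩ := ZMod.intCast_surjective b
    refine ⟨y, hb, ?_⟩
    simp only [c] at h1
    rw [map_intCast, map_intCast] at h1
    refine h1.imp (fun h1 => ?_) (fun h1 => ?_)
    · have h2 : ((x * (1 + 2 ^ (n - i - 1)) : ℤ) : ZMod (2 ^ (n - i))) = y := by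
        rw [h1]; push_cast; rfl
      rw [ZMod.intCast_eq_intCast_iff_dvd_sub] at h2
      exact_mod_cast h2
    · have h2 : ((-(x * (1 + 2 ^ (n - i - 1))) : ℤ) : ZMod (2 ^ (n - i))) = y := by
        rw [h1]; push_cast; rfl
      rw [ZMod.intCast_eq_intCast_iff_dvd_sub, sub_neg_eq_add] at h2
      exact_mod_cast h2

/-- For `p = 2` and `t ≥ 3`, take a unit `x` of `B`, its partner `y` for valuation `0` and its
partner `z` for valuation `1`. Elements of `B` are distinct modulo `2 ^ (n - 2)`, which excludes
`y ≡ x` modulo `2 ^ (n - 1)`, hence `y ≡ -x` there; but `z ≡ ±x` modulo `2 ^ (n - 2)`, so `z` would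
equal `x` or `y`, while `z ≢ ±x` modulo `2 ^ (n - 1)`. -/
theorem IsSplitterSet.false_of_two {k₁ k₂ n t : ℕ} (ht : 3 ≤ t)
    (htn : t + 3 ≤ n) (hk : k₁ + k₂ + 1 = 2 ^ t) {B : Finset (ZMod (2 ^ n))}
    (h : IsSplitterSet k₁ k₂ (2 ^ n) B) [DecidablePred (IsUnit : ZMod (2 ^ n) → Prop)]
    (hB : 2 ^ (t - 1) * (B.filter IsUnit).card = 2 ^ (n - 1)) : False := by
  obtain ⟨b, hb⟩ : (B.filter IsUnit).Nonempty := by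
    rw [← Finset.card_pos]
    refine Nat.pos_of_ne_zero fun h0 => ?_
    rw [h0, mul_zero] at hB
    exact (by positivity : (2 : ℕ) ^ (n - 1) ≠ 0) hB.symm
  obtain ⟨x, rfl⟩ := ZMod.intCast_surjective b
  have hxodd : ¬ (2 : ℤ) ∣ x := fun hd =>
    ZMod.not_isUnit_intCast_prime_pow Nat.prime_two (by omega) (by exact_mod_cast hd)
      (Finset.mem_filter.1 hb).2
  have hinj : ∀ i ≤ 2, ∀ y z : ℤ, (y : ZMod (2 ^ n)) ∈ B.filter IsUnit →
      (z : ZMod (2 ^ n)) ∈ B.filter IsUnit → (2 : ℤ) ^ (n - i) ∣ y - z → (2 : ℤ) ^ n ∣ y - z := by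
    intro i hi y z hy hz hd
    have h8 : 2 * 2 ^ i ≤ k₁ + k₂ + 1 := by
      rw [hk, ← pow_succ']
      exact Nat.pow_le_pow_right (by norm_num) (by omega)
    have := h.intCast_eq_of_dvd_sub (by norm_num) (by omega) h8 (Finset.mem_filter.1 hy).1
      (Finset.mem_filter.1 hz).1 (by exact_mod_cast hd)
    rw [eq_comm, ZMod.intCast_eq_intCast_iff_dvd_sub] at this
    exact_mod_cast this
  obtain ⟨y, hy, hxy⟩ := h.exists_unit_dvd_two_pow (i := 0) (by omega) (by omega) hk hB hb
  obtain ⟨z, hz, hxz⟩ := h.exists_unit_dvd_two_pow (i := 1) (by omega) (by omega) hk hB hb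
  obtain ⟨m, rfl⟩ : ∃ m, n = m + 2 := ⟨n - 2, by omega⟩
  have hi1 := hinj 1 (by omega)
  have hi2 := hinj 2 (by omega)
  obtain ⟨w, hw⟩ : ∃ w : ℤ, w = 2 ^ m := ⟨_, rfl⟩
  have hw0 : w ≠ 0 := by rw [hw]; positivity
  have e1 : (2 : ℤ) ^ (m + 1) = w * 2 := by rw [pow_succ, hw]
  have e2 : (2 : ℤ) ^ (m + 2) = w * 4 := by rw [pow_add, hw]; norm_num
  simp only [Nat.sub_zero, Nat.add_sub_cancel, show m + 2 - 1 = m + 1 by omega, e1, e2, ← hw]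
    at hxy hxz hi1 hi2
  have hcancel : ∀ r : ℤ, w * r = 0 → r = 0 := fun r hr => (mul_eq_zero.1 hr).resolve_left hw0
  -- with `w = 2 ^ (n - 2)`, each case makes `x` even
  rcases hxy with ⟨r, hr⟩ | ⟨r, hr⟩
  · obtain ⟨s, hs⟩ := hi1 y x hy hb ⟨2 * r + x, by linear_combination hr⟩
    have := hcancel (4 * s - 4 * r - 2 * x) (by linear_combination hr - hs)
    omega
  · rcases hxz with ⟨r', hr'⟩ | ⟨r', hr'⟩
    · obtain ⟨s, hs⟩ := hi2 z x hz hb ⟨2 * r' + x, by linear_combination hr'⟩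
      have := hcancel (4 * s - 2 * r' - x) (by linear_combination hr' - hs)
      omega
    · obtain ⟨s, hs⟩ := hi2 z y hz hy ⟨2 * r' - x - 4 * r + 2 * x, by linear_combination hr' - hr⟩
      have := hcancel (4 * s - 2 * r' + x + 4 * r - 2 * x) (by linear_combination hr' - hr - hs)
      omega

theorem theorem3p8 (k₁ k₂ n p : ℕ) (hk₁ : 0 < k₁) (hk₂ : 0 < k₂) (hn : 0 < n)
    (hk : 4 ≤ k₁ + k₂) (hp : p.Prime) (hdvd : p ∣ k₁ + k₂ + 1) (hne : p ≠ k₁ + k₂ + 1)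
    (hB : ∃ B : Finset (ZMod (p ^ n)), IsPerfectSplitterSet k₁ k₂ (p ^ n) B) :
    p ^ n = k₁ + k₂ + 1 := by
  classical
  obtain ⟨B, hB⟩ := hB
  obtain ⟨t, ht, ⟨r, rfl⟩, hkt, hcard⟩ := hB.exists_exponent hp hn.ne' hdvd hne
  by_contra hcon
  have hr : 2 ≤ r := by
    rcases (by omega : r = 0 ∨ r = 1 ∨ 2 ≤ r) with rfl | rfl | h
    · simp at hn
    · exact absurd (by rw [hkt, mul_one]) hcon
    · exact h
  have hrt : t * 2 ≤ t * r := Nat.mul_le_mul_left t hr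
  by_cases hp2 : p = 2
  · subst hp2
    have ht3 : 3 ≤ t := by
      -- `2 ^ t = 4` would mean `k₁ + k₂ = 3`
      by_contra h3
      obtain rfl : t = 2 := by omega
      norm_num at hkt
      omega
    exact hB.isSplitterSet.false_of_two ht3 (by omega) hkt (by convert hcard)
  · refine hB.false_of_odd_prime hp hp2 ht (by omega) hkt ?_
    rw [← Finset.card_pos]
    refine Nat.pos_of_ne_zero fun h0 => ?_
    rw [h0, mul_zero] at hcard
    exact (pow_pos hp.pos _).ne hcard
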